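/- For a finite simple graph $G$ on $n$ vertices let $S_k(G)=\sum_{i=1}^n\lambda_i(G)^k$ be its $k$-th spectral moment, where $\lambda_1(G),\dots,\lambda_n(G)$ are the eigenvalues of the adjacency matrix of $G$. For graphs $G,H$ on $n$ vertices write $G=_sH$ if $S_i(G)=S_i(H)$ for $0\le i\le n-1$; write $G\prec_sH$ if for some $1\le k\le n-1$ one has $S_i(G)=S_i(H)$ for $0\le i\le k-1$ and $S_k(G)<S_k(H)$; and write $G\preceq_sH$ if $G\prec_sH$ or $G=_sH$. A tree has a $(p,q)$-bipartition, $p\le q$, if its vertex set is the disjoint union of a set of $p$ vertices and a set of $q$ vertices such that each edge joins the two sets. For $k,l\ge 0$ with $k+l+1\le p$ and $l+2\le q$ let $B_{p,q}^{k,l}$ be the tree with $p$ white and $q$ black vertices in which one white vertex is adjacent to all $q$ black vertices $u,v,w_1,\dots,w_{q-2}$, and each of the other $p-1$ white vertices is a leaf, of which $p-1-k-l$ are adjacent to $u$, $k$ are adjacent to $v$, and one is adjacent to each of $w_1,\dots,w_l$. Theorem. Let $4\le p=q$, and let $T$ be a tree with a $(p,q)$-bipartition which is not isomorphic to any of $B_{p,q}^{0,0}$,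 $B_{p,q}^{0,1}$, $B_{p,q}^{2,0}$. Then $T\preceq_s B_{p,q}^{0,2}$, and $T=_sB_{p,q}^{0,2}$ if and only if $T\cong B_{p,q}^{0,2}$. -/

import Mathlib

open scoped Classical in
/-- The `k`-th spectral moment of a finite graph: the sum of the `k`-th powers of the
eigenvalues (with multiplicity) of its real adjacency matrix. -/
noncomputable def spectralMoment {V : Type*} [Fintype V] (G : SimpleGraph V) (k : ℕ) : ℝ :=
  ∑ i : V, ((G.isHermitian_adjMatrix ℝ).eigenvalues i) ^ k

/-- `G =ₛ H`: both graphs have `n` vertices and their spectral moments of orders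
`0, 1, …, n - 1` agree. -/
def SEq {V W : Type*} [Fintype V] [Fintype W] (G : SimpleGraph V) (H : SimpleGraph W) : Prop :=
  Fintype.card V = Fintype.card W ∧
    ∀ i < Fintype.card V, spectralMoment G i = spectralMoment H i

/-- `G ≺ₛ H`: both graphs have `n` vertices and, for some `1 ≤ k ≤ n - 1`, the moments of orders
`0, …, k - 1` agree while the `k`-th moment of `G` is smaller than that of `H`. -/
def SLt {V W : Type*} [Fintype V] [Fintype W] (G : SimpleGraph V) (H : SimpleGraph W) : Prop :=
  Fintype.card V = Fintype.card W ∧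
    ∃ k, 1 ≤ k ∧ k < Fintype.card V ∧
      (∀ i < k, spectralMoment G i = spectralMoment H i) ∧
      spectralMoment G k < spectralMoment H k

/-- `G ⪯ₛ H`: `G ≺ₛ H` or `G =ₛ H`. -/
def SLe {V W : Type*} [Fintype V] [Fintype W] (G : SimpleGraph V) (H : SimpleGraph W) : Prop :=
  SLt G H ∨ SEq G H

/-- `G` has a `(p, q)`-bipartition, where `p ≤ q`: its vertex set is the disjoint union of a set of
`p` vertices and a set of `q` vertices such that each edge joins the two sets. -/
def HasBipartition {V : Type*} [Fintype V] (G : SimpleGraph V) (p q : ℕ) : Prop :=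
  p ≤ q ∧ ∃ s t : Set V,
    G.IsBipartiteWith s t ∧ s ∪ t = Set.univ ∧ s.ncard = p ∧ t.ncard = q

/-- `T` is a tree with a `(p, q)`-bipartition. -/
def IsTreeWithBipartition {V : Type*} [Fintype V] (T : SimpleGraph V) (p q : ℕ) : Prop :=
  T.IsTree ∧ HasBipartition T p q

/-- In the tree `B_{p,q}^{k,l}`, the index of the black vertex carrying the pendant white vertex
`i` (for `1 ≤ i < p`): the first `k` pendant white vertices hang at the black vertex `v = 1`, the
next `l` hang at the distinct black vertices `2, …, l + 1` (one at each), and the remaining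
`p - 1 - k - l` hang at the black vertex `u = 0`. -/
def treeBParent (k l i : ℕ) : ℕ :=
  if i ≤ k then 1 else if i ≤ k + l then i - k + 1 else 0

/-- The tree `B_{p,q}^{k,l}` (for `k + l + 1 ≤ p` and `l + 2 ≤ q`) with `p` white vertices `inl i`
and `q` black vertices `inr j`. The white vertex `inl 0` is adjacent to all black vertices, and
every other white vertex `inl i` is a leaf hanging at the black vertex `treeBParent k l i`.
So `u` has degree `p - k - l`, `v` has degree `k + 1`, `l` black vertices have degree `2`, and the
remaining `q - l - 2` black vertices are leaves. -/
def treeB (p q k l : ℕ) : SimpleGraph (Fin p ⊕ Fin q) where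
  Adj
    | .inl i, .inr j => i.val = 0 ∨ j.val = treeBParent k l i.val
    | .inr j, .inl i => i.val = 0 ∨ j.val = treeBParent k l i.val
    | _, _ => False
  symm := ⟨by rintro (a | a) (b | b) h <;> exact h⟩
  loopless := ⟨by rintro (a | a) h <;> exact h⟩

/-! Write p = q = n + 1. Odd moments of a bipartite graph vanish, and S_0 and S_2 agree for all
trees of the same order, so S_4 is the first moment that can differ. For a tree S_4 = 2 Σ d² - Σ d;
for B^{0,2} it equals 4n² + 14.

If no vertex has degree n + 1, the numbers d - 1 on each side sum to n and are at most n - 1. Their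
squares then sum to at most (n - 1)² + 1, which gives S_4 ≤ 4n² + 10.

If some vertex has degree n + 1, it is joined to the whole opposite class, and edge counting makes
all other vertices on its side leaves. The tree is then a `starPendant`, determined by the numbers
c_b of leaves at the opposite vertices, with Σ c_b = n. Its even moments are traces of powers of J +
diag(c), with J the all-ones matrix, so S_4 depends only on Σ c_b². A count of at least n - 2 leaves
only the partitions n, (n-1)+1, (n-2)+2, (n-2)+1+1: the three excluded trees and B^{0,2}. If all
counts are at most n - 3, then Σ c_b² < (n - 2)² + 2, except for a possible tie at n = 6 (as for 3+3
against 4+1+1), which S_6 breaks. -/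

open Matrix in
theorem Matrix.IsHermitian.sum_eigenvalues_pow {n : Type*} [Fintype n] [DecidableEq n]
    {A : Matrix n n ℝ} (hA : A.IsHermitian) (k : ℕ) :
    ∑ i, hA.eigenvalues i ^ k = (A ^ k).trace := by
  conv_rhs => rw [hA.spectral_theorem, ← map_pow, Unitary.conjStarAlgAut_apply, trace_mul_cycle,
    Unitary.coe_star_mul_self, one_mul, diagonal_pow, trace_diagonal]
  simp

/-! ### Spectral moments as traces; orders two and four -/

section Moments

variable {V W : Type*} [Fintype V] [Fintype W]

theorem spectralMoment_eq_trace [DecidableEq V] (G : SimpleGraph V) [DecidableRel G.Adj] (k : ℕ) :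
    spectralMoment G k = (G.adjMatrix ℝ ^ k).trace := by
  classical
  rw [spectralMoment]
  refine (@Matrix.IsHermitian.sum_eigenvalues_pow V _ (fun a b => Classical.propDecidable (a = b))
    _ _ k).trans ?_
  congr!

theorem spectralMoment_zero (G : SimpleGraph V) : spectralMoment G 0 = Fintype.card V := by
  simp [spectralMoment]

theorem SimpleGraph.Iso.spectralMoment_eq {G : SimpleGraph V} {H : SimpleGraph W} (e : G ≃g H)
    (k : ℕ) : spectralMoment G k = spectralMoment H k := by
  classical
  have h : G.adjMatrix ℝ = (H.adjMatrix ℝ).submatrix e.toEquiv e.toEquiv := by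
    ext i j
    simp [SimpleGraph.adjMatrix_apply, e.map_adj_iff]
  have hp : ∀ k : ℕ, G.adjMatrix ℝ ^ k = (H.adjMatrix ℝ ^ k).submatrix e.toEquiv e.toEquiv := by
    intro k
    induction k with
    | zero => exact (Matrix.submatrix_one_equiv e.toEquiv).symm
    | succ k ih => rw [pow_succ, pow_succ, ih, h, Matrix.submatrix_mul_equiv]
  rw [spectralMoment_eq_trace, spectralMoment_eq_trace, hp]
  exact Equiv.sum_comp e.toEquiv fun i => (H.adjMatrix ℝ ^ k) i i

/-- Conjugating by the diagonal sign matrix of the bipartition turns the adjacency matrix A into -A.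
-/
theorem SimpleGraph.IsBipartiteWith.spectralMoment_odd {G : SimpleGraph V} {s t : Set V}
    (h : G.IsBipartiteWith s t) {k : ℕ} (hk : Odd k) : spectralMoment G k = 0 := by
  classical
  set ε : V → ℝ := fun v => if v ∈ s then 1 else -1 with hε
  set D := Matrix.diagonal ε with hD
  set A := G.adjMatrix ℝ with hA
  have hDD : D * D = 1 := by
    rw [hD, Matrix.diagonal_mul_diagonal, ← Matrix.diagonal_one]
    congr 1
    ext v
    simp only [hε]
    split_ifs <;> norm_num
  have hDAD : D * A * D = -A := by
    ext v w
    simp only [hD, Matrix.mul_diagonal, Matrix.diagonal_mul, Matrix.neg_apply, hA,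
      SimpleGraph.adjMatrix_apply, hε]
    by_cases hvw : G.Adj v w
    · rcases h.mem_of_adj hvw with ⟨hv, hw⟩ | ⟨hv, hw⟩
      · have := Set.disjoint_right.mp h.disjoint hw
        simp [hvw, hv, this]
      · have := Set.disjoint_right.mp h.disjoint hv
        simp [hvw, hw, this]
    · simp [hvw]
  have hpow : ∀ k : ℕ, (-A) ^ k = D * A ^ k * D := by
    intro k
    induction k with
    | zero => simp [hDD]
    | succ k ih =>
      rw [pow_succ, ih, ← hDAD, pow_succ]
      calc D * A ^ k * D * (D * A * D) = D * A ^ k * (D * D) * A * D := by simp only [mul_assoc]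
        _ = D * (A ^ k * A) * D := by rw [hDD]; simp only [mul_assoc, mul_one]
  have htr : ((-A) ^ k).trace = (A ^ k).trace := by
    rw [hpow, Matrix.trace_mul_cycle, hDD, one_mul]
  rw [hk.neg_pow, Matrix.trace_neg] at htr
  rw [spectralMoment_eq_trace]
  linarith

theorem spectralMoment_two (G : SimpleGraph V) [DecidableRel G.Adj] :
    spectralMoment G 2 = ∑ v, (G.degree v : ℝ) := by
  classical
  rw [spectralMoment_eq_trace, sq, Matrix.trace]
  simp only [Matrix.diag_apply, SimpleGraph.adjMatrix_mul_self_apply_self]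

theorem SimpleGraph.IsAcyclic.eq_of_common_neighbors {V : Type*} {G : SimpleGraph V}
    (hG : G.IsAcyclic) {u v x y : V} (huv : u ≠ v) (hux : G.Adj u x) (hxv : G.Adj x v)
    (huy : G.Adj u y) (hyv : G.Adj y v) : x = y := by
  have key : ∀ z (h₁ : G.Adj u z) (h₂ : G.Adj z v),
      (Walk.cons h₁ (Walk.cons h₂ Walk.nil)).IsPath := by
    intro z h₁ h₂
    simp [Walk.isPath_def, h₁.ne, h₂.ne, huv]
  have := (hG.subsingleton_path u v).elim ⟨_, key x hux hxv⟩ ⟨_, key y huy hyv⟩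
  have h2 := congrArg (fun p : G.Path u v => (p : G.Walk u v).support) this
  simpa using h2

/-- Off the diagonal A² has entries 0 or 1, since two vertices of a forest share at most one
neighbor. Squaring changes only the diagonal entries, which are the degrees, and the entries of A²
sum to Σ d². -/
theorem SimpleGraph.IsAcyclic.spectralMoment_four {G : SimpleGraph V} [DecidableRel G.Adj]
    (hG : G.IsAcyclic) :
    spectralMoment G 4 = 2 * ∑ v, (G.degree v : ℝ) ^ 2 - ∑ v, (G.degree v : ℝ) := by
  classical
  set A := G.adjMatrix ℝ with hA
  have hentry : ∀ u v, u ≠ v → (A * A) u v * (A * A) v u = (A * A) u v := by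
    intro u v huv
    have hsymm : (A * A) v u = (A * A) u v := by
      have := congrFun (congrFun (Matrix.transpose_mul A A) u) v
      rwa [hA, SimpleGraph.transpose_adjMatrix, ← hA, Matrix.transpose_apply] at this
    have h01 : (A * A) u v = 0 ∨ (A * A) u v = 1 := by
      by_cases hx : ∃ x, G.Adj u x ∧ G.Adj x v
      · right
        obtain ⟨x, hux, hxv⟩ := hx
        rw [Matrix.mul_apply, Finset.sum_eq_single x]
        · simp [hA, hux, hxv]
        · intro y _ hyx
          by_contra hne
          apply hyx
          have h1 : G.Adj u y := by
            by_contra h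
            simp [hA, h] at hne
          have h2 : G.Adj y v := by
            by_contra h
            simp [hA, h] at hne
          exact hG.eq_of_common_neighbors huv h1 h2 hux hxv
        · simp
      · left
        rw [Matrix.mul_apply]
        refine Finset.sum_eq_zero fun y _ => ?_
        by_cases h1 : G.Adj u y
        · have h2 : ¬ G.Adj y v := fun h2 => hx ⟨y, h1, h2⟩
          simp [hA, h2]
        · simp [hA, h1]
    rw [hsymm]
    rcases h01 with h | h <;> simp [h]
  have hdiag : ∀ u, (A * A) u u = G.degree u := fun u => by
    rw [hA, SimpleGraph.adjMatrix_mul_self_apply_self]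
  have hall : ∑ u, ∑ v, (A * A) u v = ∑ v, (G.degree v : ℝ) ^ 2 := by
    have h1 : ∀ x, ∑ u, A u x = (G.degree x : ℝ) := fun x => by
      simp [hA, SimpleGraph.adjMatrix_apply, Finset.sum_boole,
        ← SimpleGraph.card_neighborFinset_eq_degree, SimpleGraph.neighborFinset_eq_filter,
        SimpleGraph.adj_comm]
    have h2 : ∀ x, ∑ u, A x u = (G.degree x : ℝ) := fun x => by
      simp [hA, SimpleGraph.adjMatrix_apply, Finset.sum_boole,
        ← SimpleGraph.card_neighborFinset_eq_degree, SimpleGraph.neighborFinset_eq_filter]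
    calc ∑ u, ∑ v, (A * A) u v = ∑ u, ∑ v, ∑ x, A u x * A x v := by simp only [Matrix.mul_apply]
      _ = ∑ u, ∑ x, ∑ v, A u x * A x v := by
        refine Finset.sum_congr rfl fun u _ => Finset.sum_comm
      _ = ∑ u, ∑ x, A u x * G.degree x := by simp only [← Finset.mul_sum, h2]
      _ = ∑ x, ∑ u, A u x * G.degree x := Finset.sum_comm
      _ = _ := by simp only [← Finset.sum_mul, h1, sq]
  have hsplit : ∀ u, ∑ v, (A * A) u v * (A * A) v u
      = ∑ v, (A * A) u v + ((G.degree u : ℝ) ^ 2 - G.degree u) := by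
    intro u
    rw [← Finset.add_sum_erase _ _ (Finset.mem_univ u),
      ← Finset.add_sum_erase _ (fun v => (A * A) u v) (Finset.mem_univ u), hdiag]
    rw [Finset.sum_congr rfl fun v hv => hentry u v (Finset.ne_of_mem_erase hv).symm]
    ring
  rw [spectralMoment_eq_trace, show 4 = 2 + 2 from rfl, pow_add, sq, ← hA, Matrix.trace]
  simp only [Matrix.diag_apply, Matrix.mul_apply (M := A * A)]
  simp only [hsplit, Finset.sum_add_distrib, Finset.sum_sub_distrib, hall]
  ring

theorem SimpleGraph.Iso.sEq {G : SimpleGraph V} {H : SimpleGraph W} (e : G ≃g H) : SEq G H :=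
  ⟨e.card_eq, fun _ _ => e.spectralMoment_eq _⟩

theorem SLt.not_sEq {G : SimpleGraph V} {H : SimpleGraph W} (h : SLt G H) : ¬ SEq G H := by
  rintro ⟨-, heq⟩
  obtain ⟨-, k, -, hk, -, hlt⟩ := h
  exact hlt.ne (heq k hk)

theorem SLt.of_bipartite {G : SimpleGraph V} {H : SimpleGraph W} {s t : Set V} {s' t' : Set W}
    (hG : G.IsBipartiteWith s t) (hH : H.IsBipartiteWith s' t')
    (hcard : Fintype.card V = Fintype.card W) {k : ℕ} (hk : 0 < k) (hkV : 2 * k < Fintype.card V)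
    (heq : ∀ i, 0 < i → i < k → spectralMoment G (2 * i) = spectralMoment H (2 * i))
    (hlt : spectralMoment G (2 * k) < spectralMoment H (2 * k)) : SLt G H := by
  refine ⟨hcard, 2 * k, by omega, hkV, fun i hi => ?_, hlt⟩
  rcases Nat.even_or_odd' i with ⟨j, rfl | rfl⟩
  · rcases Nat.eq_zero_or_pos j with rfl | hj
    · simp [spectralMoment_zero, hcard]
    · exact heq j hj (by omega)
  · rw [hG.spectralMoment_odd ⟨j, rfl⟩, hH.spectralMoment_odd ⟨j, rfl⟩]

end Moments

/-! ### Moments of trees with a dominating vertex -/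

section StarPendant

variable {A B : Type*}

/-- The bipartite graph with parts `Option A` and `B` in which `none` is adjacent to all of `B` and
each `some a` is a leaf attached to `f a`. -/
def starPendant (f : A → B) : SimpleGraph (Option A ⊕ B) where
  Adj
    | .inl a, .inr b => ∀ x ∈ a, f x = b
    | .inr b, .inl a => ∀ x ∈ a, f x = b
    | _, _ => False
  symm := ⟨by rintro (a | a) (b | b) h <;> exact h⟩
  loopless := ⟨by rintro (a | a) h <;> exact h⟩

theorem isBipartiteWith_starPendant (f : A → B) :
    (starPendant f).IsBipartiteWith (Set.range Sum.inl) (Set.range Sum.inr) where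
  disjoint := Set.isCompl_range_inl_range_inr.disjoint
  mem_of_adj := by
    rintro (a | a) (b | b) h
    · exact h.elim
    · simp
    · simp
    · exact h.elim

/-- The number of pendant vertices attached to `b`. -/
noncomputable def pendantCount (f : A → B) (b : B) : ℕ := Nat.card {a // f a = b}

theorem sum_pendantCount [Finite A] [Fintype B] (f : A → B) :
    ∑ b, pendantCount f b = Nat.card A := by
  rw [← Nat.card_congr (Equiv.sigmaFiberEquiv f), Nat.card_sigma]
  rfl

theorem pendantCount_eq_card_filter [Fintype A] [DecidableEq B] (f : A → B) (b : B) :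
    pendantCount f b = (Finset.univ.filter fun a => f a = b).card := by
  rw [pendantCount, Nat.card_eq_fintype_card, Fintype.card_subtype]

-- With M the biadjacency matrix, the even powers of the adjacency matrix are block diagonal with
-- blocks (M Mᵀ)^k and (Mᵀ M)^k, of equal trace for k > 0. The all-ones row `none` of M contributes
-- the 1 to every entry of Mᵀ M, the leaf rows contribute the diagonal.
open Matrix in
theorem spectralMoment_starPendant [Fintype A] [Fintype B] [DecidableEq B] (f : A → B) {k : ℕ}
    (hk : 0 < k) : spectralMoment (starPendant f) (2 * k) =
      2 * ((Matrix.of fun i j : B => 1 + if i = j then (pendantCount f j : ℝ) else 0) ^ k).trace := by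
  classical
  set M : Matrix (Option A) B ℝ := Matrix.of fun a b => if ∀ x ∈ a, f x = b then 1 else 0 with hM
  have hA : (starPendant f).adjMatrix ℝ = fromBlocks 0 M Mᵀ 0 := by
    ext (i | i) (j | j) <;> simp [SimpleGraph.adjMatrix_apply, starPendant, hM]
  have hpow : ∀ k : ℕ, (starPendant f).adjMatrix ℝ ^ (2 * k) =
      fromBlocks ((M * Mᵀ) ^ k) 0 0 ((Mᵀ * M) ^ k) := by
    intro k
    induction k with
    | zero => simp [fromBlocks_one]
    | succ k ih =>
      rw [mul_add, pow_add, ih, hA, mul_one, sq, fromBlocks_multiply, fromBlocks_multiply]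
      simp [pow_succ]
  have hcomm : ∀ k : ℕ, M * (Mᵀ * M) ^ k = (M * Mᵀ) ^ k * M := by
    intro k
    induction k with
    | zero => simp
    | succ k ih => rw [pow_succ, ← Matrix.mul_assoc, ih, pow_succ]; simp only [Matrix.mul_assoc]
  have htr : ((M * Mᵀ) ^ k).trace = ((Mᵀ * M) ^ k).trace := by
    obtain ⟨j, rfl⟩ := Nat.exists_eq_succ_of_ne_zero hk.ne'
    rw [pow_succ, ← Matrix.mul_assoc, ← hcomm, Matrix.mul_assoc, Matrix.trace_mul_comm,
      Matrix.mul_assoc, ← pow_succ]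
  have hMM : Mᵀ * M = Matrix.of fun i j : B => 1 + if i = j then (pendantCount f j : ℝ) else 0 := by
    ext i j
    rw [Matrix.mul_apply, Fintype.sum_option]
    simp only [hM, Matrix.transpose_apply, Matrix.of_apply, pendantCount_eq_card_filter]
    congr 1
    · simp
    · by_cases hij : i = j
      · subst hij
        simp [← ite_and]
      · rw [if_neg hij]
        refine Finset.sum_eq_zero fun a _ => ?_
        by_cases h : f a = i
        · have : f a ≠ j := fun h' => hij (h.symm.trans h')
          simp [this]
        · simp [h]
  rw [spectralMoment_eq_trace, hpow, two_mul, ← hMM]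
  nth_rw 1 [← htr]
  simp [Matrix.trace, Fintype.sum_sum_type]

variable [Fintype A] [Fintype B] (f : A → B)

theorem spectralMoment_starPendant_two :
    spectralMoment (starPendant f) 2 = 2 * (Fintype.card B + ∑ b, (pendantCount f b : ℝ)) := by
  classical
  rw [show 2 = 2 * 1 from rfl, spectralMoment_starPendant f one_pos, pow_one, Matrix.trace]
  simp [Finset.sum_add_distrib]

theorem spectralMoment_starPendant_four :
    spectralMoment (starPendant f) 4 = 2 * ((Fintype.card B : ℝ) ^ 2 +
      2 * ∑ b, (pendantCount f b : ℝ) + ∑ b, (pendantCount f b : ℝ) ^ 2) := by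
  classical
  rw [show 4 = 2 * 2 from rfl, spectralMoment_starPendant f two_pos, sq, Matrix.trace]
  simp only [Matrix.diag_apply, Matrix.mul_apply, Matrix.of_apply]
  simp only [add_mul, mul_add, Finset.sum_add_distrib, mul_ite, ite_mul, mul_zero, zero_mul, one_mul,
    mul_one, Finset.sum_ite_eq, Finset.sum_ite_eq', Finset.mem_univ, if_true, Finset.sum_const,
    Finset.card_univ, nsmul_eq_mul, sq]
  ring

theorem spectralMoment_starPendant_six :
    spectralMoment (starPendant f) 6 = 2 * ((Fintype.card B : ℝ) ^ 3 +
      3 * Fintype.card B * ∑ b, (pendantCount f b : ℝ) + 3 * ∑ b, (pendantCount f b : ℝ) ^ 2 +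
      ∑ b, (pendantCount f b : ℝ) ^ 3) := by
  classical
  rw [show 6 = 2 * 3 from rfl, spectralMoment_starPendant f three_pos,
    pow_three' (_ : Matrix B B ℝ), Matrix.trace]
  simp only [Matrix.diag_apply, Matrix.mul_apply, Matrix.of_apply]
  simp only [add_mul, mul_add, Finset.sum_add_distrib, mul_ite, ite_mul, mul_zero, zero_mul, one_mul,
    mul_one, Finset.sum_ite_eq, Finset.sum_ite_eq', Finset.mem_univ, if_true, Finset.sum_const,
    Finset.card_univ, nsmul_eq_mul, pow_succ, pow_zero]
  simp only [← Finset.mul_sum]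
  ring

end StarPendant

/-! ### Sums of squares with given total and bounded terms -/

section SumSq

variable {ι : Type*} {s : Finset ι} {b : ι → ℕ} {N : ℕ}

theorem Finset.sum_sq_le_sq_sum_nat (s : Finset ι) (b : ι → ℕ) :
    ∑ i ∈ s, b i ^ 2 ≤ (∑ i ∈ s, b i) ^ 2 := by
  rw [sq (∑ i ∈ s, b i), Finset.sum_mul]
  refine Finset.sum_le_sum fun i hi => ?_
  rw [sq]
  exact Nat.mul_le_mul_left _ (Finset.single_le_sum (fun _ _ => Nat.zero_le _) hi)

/-- Splits off a largest term. The bound by `b i ^ 2 + r ^ 2` serves when that term is large, the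
bound by `b i * N` when it is small. -/
theorem exists_max_sum_sq_le (hN : 0 < N) (hsum : ∑ i ∈ s, b i = N) :
    ∃ i ∈ s, ∃ r, 0 < b i ∧ b i + r = N ∧ (∀ j ∈ s, b j ≤ b i) ∧
      ∑ j ∈ s, b j ^ 2 ≤ b i ^ 2 + r ^ 2 ∧ ∑ j ∈ s, b j ^ 2 ≤ b i * N := by
  classical
  have hs : s.Nonempty := by
    by_contra h
    rw [Finset.not_nonempty_iff_eq_empty] at h
    simp [h] at hsum
    omega
  obtain ⟨i, hi, hmax⟩ := s.exists_max_image b hs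
  refine ⟨i, hi, ∑ j ∈ s.erase i, b j, ?_, ?_, hmax, ?_, ?_⟩
  · by_contra h0
    have : ∑ j ∈ s, b j = 0 := Finset.sum_eq_zero fun j hj => by have := hmax j hj; omega
    omega
  · rw [Finset.add_sum_erase _ _ hi, hsum]
  · rw [← Finset.add_sum_erase _ _ hi]
    exact Nat.add_le_add_left (Finset.sum_sq_le_sq_sum_nat _ _) _
  · rw [← hsum, Finset.mul_sum]
    refine Finset.sum_le_sum fun j hj => ?_
    rw [sq]
    exact Nat.mul_le_mul_right _ (hmax j hj)

theorem sum_sq_le_of_forall_add_one_le (hN : 0 < N) (hsum : ∑ i ∈ s, b i = N)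
    (hb : ∀ i ∈ s, b i + 1 ≤ N) : ∑ i ∈ s, b i ^ 2 + 2 * N ≤ N ^ 2 + 2 := by
  obtain ⟨i, hi, r, hpos, hr, -, hsq, -⟩ := exists_max_sum_sq_le hN hsum
  have := hb i hi
  obtain ⟨m, hm⟩ : ∃ m, b i = m + 1 := ⟨b i - 1, by omega⟩
  obtain ⟨r, rfl⟩ : ∃ r', r = r' + 1 := ⟨r - 1, by omega⟩
  rw [hm] at hr hsq
  subst hr
  nlinarith [Nat.zero_le (m * r)]

/-- The threshold N² - 4N + 6 is (N - 2)² + 2, the value at (N-2)+1+1. A maximum of at most 2 is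
handled by the bound `b i * N`. Otherwise maximum and remainder are both at least 3, so the sum is
at most (N - 3)² + 9, which reaches the threshold only for N = 6. -/
theorem sum_sq_lt_or_of_forall_add_three_le (hN : 0 < N) (hsum : ∑ i ∈ s, b i = N)
    (hb : ∀ i ∈ s, b i + 3 ≤ N) : ∑ i ∈ s, b i ^ 2 + 4 * N < N ^ 2 + 6 ∨
      (∑ i ∈ s, b i ^ 2 + 4 * N = N ^ 2 + 6 ∧ N = 6) := by
  obtain ⟨i, hi, r, hpos, hr, -, hsq, hmul⟩ := exists_max_sum_sq_le hN hsum
  have := hb i hi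
  rcases Nat.lt_or_ge (b i) 3 with h | h
  · left
    rcases Nat.lt_or_ge N 5 with h5 | h5
    · obtain rfl : N = 4 := by omega
      have : b i = 1 := by omega
      rw [this] at hmul
      omega
    · have : b i * N ≤ 2 * N := Nat.mul_le_mul_right _ (by omega)
      nlinarith
  · obtain ⟨m, hm⟩ : ∃ m, b i = m + 3 := ⟨b i - 3, by omega⟩
    obtain ⟨r, rfl⟩ : ∃ r', r = r' + 3 := ⟨r - 3, by omega⟩
    rw [hm] at hr hsq
    have hle : ∑ j ∈ s, b j ^ 2 + 6 * N ≤ N ^ 2 + 18 := by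
      subst hr
      nlinarith [Nat.zero_le (m * r)]
    rcases Nat.lt_or_ge 6 N with h6 | h6
    · left; omega
    · obtain rfl : N = 6 := by omega
      omega

end SumSq

/-! ### Recognizing the trees B from their leaf counts -/

section Iso

variable {A B A' B' : Type*}

theorem starPendant_iso_of_pendantCount_eq [Finite A] [Finite A'] {f : A → B} {g : A' → B'}
    (e : B ≃ B') (h : ∀ b, pendantCount f b = pendantCount g (e b)) :
    Nonempty (starPendant f ≃g starPendant g) := by
  have key : ∀ c : B', Nonempty ({a // e (f a) = c} ≃ {a // g a = c}) := by
    intro c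
    rw [← Finite.card_eq]
    have := h (e.symm c)
    rw [pendantCount, pendantCount, e.apply_symm_apply] at this
    rw [← this]
    simp only [Equiv.eq_symm_apply]
  let e' : A ≃ A' := Equiv.ofFiberEquiv fun c => (key c).some
  have he' : ∀ a, g (e' a) = e (f a) := fun a => Equiv.ofFiberEquiv_map _ a
  refine ⟨⟨(Equiv.optionCongr e').sumCongr e, ?_⟩⟩
  rintro (a | a) (b | b) <;> try exact Iff.rfl
  · rcases a with _ | a <;> simp [starPendant, he']
  · rcases b with _ | b <;> simp [starPendant, he']

/-- The total number of leaves is fixed, so the count at one vertex follows from the others. -/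
theorem pendantCount_eq_of_eq_off [Finite A] [Finite A'] [Fintype B] [Fintype B'] {f : A → B}
    {g : A' → B'} (hA : Nat.card A = Nat.card A') (e : B ≃ B') (b₀ : B)
    (h : ∀ b, b ≠ b₀ → pendantCount f b = pendantCount g (e b)) (b : B) :
    pendantCount f b = pendantCount g (e b) := by
  classical
  by_cases hb : b = b₀
  · subst hb
    have h1 := sum_pendantCount f
    have h2 := sum_pendantCount g
    rw [← e.sum_comp] at h2
    rw [← Finset.add_sum_erase _ _ (Finset.mem_univ b)] at h1 h2
    rw [Finset.sum_congr rfl fun c hc => h c (Finset.ne_of_mem_erase hc)] at h1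
    omega
  · exact h b hb

theorem treeBParent_lt {n q k l : ℕ} (hq : l + 2 ≤ q) (i : Fin n) :
    treeBParent k l (i + 1) < q := by
  unfold treeBParent
  split_ifs <;> omega

/-- The black vertex of `B_{n+1,q}^{k,l}` carrying a given pendant white vertex. -/
def treeBAttach (n k l : ℕ) {q : ℕ} (hq : l + 2 ≤ q) (i : Fin n) : Fin q :=
  ⟨treeBParent k l (i + 1), treeBParent_lt hq i⟩

theorem treeB_iso_starPendant (n k l : ℕ) {q : ℕ} (hq : l + 2 ≤ q) :
    Nonempty (treeB (n + 1) q k l ≃g starPendant (treeBAttach n k l hq)) := by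
  have key : ∀ (a : Fin (n + 1)) (b : Fin q),
      (∀ x ∈ finSuccEquiv n a, treeBAttach n k l hq x = b) ↔
        (a.val = 0 ∨ b.val = treeBParent k l a.val) := by
    intro a b
    cases a using Fin.cases with
    | zero => simp
    | succ a =>
      rw [finSuccEquiv_succ]
      simp only [Option.mem_some_iff, forall_eq']
      simp only [treeBAttach, Fin.ext_iff, Fin.val_succ,
        Nat.succ_ne_zero, false_or]
      exact eq_comm
  refine ⟨⟨(finSuccEquiv n).sumCongr (Equiv.refl _), ?_⟩⟩
  rintro (a | a) (b | b) <;> try exact Iff.rfl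
  · exact key a b
  · exact key b a

theorem pendantCount_treeBAttach {n k l q : ℕ} (hq : l + 2 ≤ q) (hn : k + l ≤ n) (j : Fin q) :
    pendantCount (treeBAttach n k l hq) j =
      if j.val = 0 then n - k - l else if j.val = 1 then k else if j.val < l + 2 then 1 else 0 := by
  have hset : ∀ j : Fin q, pendantCount (treeBAttach n k l hq) j =
      ((Finset.range n).filter fun i => treeBParent k l (i + 1) = j.val).card := by
    intro j
    rw [pendantCount_eq_card_filter, ← Finset.card_map Fin.valEmbedding]
    congr 1
    ext i
    simp [treeBAttach, Fin.ext_iff, Fin.exists_iff]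
    tauto
  rw [hset]
  have hcard : ∀ m, (Finset.Ico m n).card = n - m := fun m => Nat.card_Ico m n
  split_ifs with h0 h1 h2
  · rw [Nat.sub_sub, ← hcard]
    congr 1
    ext i
    simp only [Finset.mem_filter, Finset.mem_range, Finset.mem_Ico]
    unfold treeBParent
    split_ifs <;> omega
  · rw [← Finset.card_range k]
    congr 1
    ext i
    simp only [Finset.mem_filter, Finset.mem_range, Finset.card_range]
    unfold treeBParent
    split_ifs <;> omega
  · rw [Finset.card_eq_one]
    -- The leaf at black vertex j is white vertex k + j - 1; the index in `Fin n` is one lower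
    -- because white vertex 0 is the center.
    refine ⟨k + j - 2, ?_⟩
    ext i
    simp only [Finset.mem_filter, Finset.mem_range, Finset.mem_singleton]
    unfold treeBParent
    split_ifs <;> omega
  · rw [Finset.card_eq_zero, Finset.filter_eq_empty_iff]
    intro i _
    unfold treeBParent
    split_ifs <;> omega

theorem exists_equiv_eq_on [Fintype B] [Fintype B'] (hcard : Fintype.card B = Fintype.card B')
    (S : Finset B) (f : B → B') (hf : Set.InjOn f S) :
    ∃ e : B ≃ B', ∀ b ∈ S, e b = f b := by
  classical
  obtain ⟨g, hg⟩ := Finset.exists_equiv_extend_of_card_eq (t := (Finset.univ : Finset B'))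
    (by simp [hcard]) (Finset.subset_univ (S.image f)) hf
  exact ⟨g.trans (Equiv.subtypeUnivEquiv fun x => Finset.mem_univ x), fun b hb => hg b hb⟩

theorem iso_treeB_of_pendantCount [Fintype A] [Fintype B] {f : A → B} {n q k l : ℕ}
    (hA : Fintype.card A = n) (hq : l + 2 ≤ q) (hn : k + l ≤ n) (e : B ≃ Fin q) {b₀ : B}
    (h : ∀ b, b ≠ b₀ → pendantCount f b = if (e b).val = 0 then n - k - l else
      if (e b).val = 1 then k else if (e b).val < l + 2 then 1 else 0) :
    Nonempty (starPendant f ≃g treeB (n + 1) q k l) := by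
  obtain ⟨e₁⟩ := treeB_iso_starPendant n k l hq
  obtain ⟨e₂⟩ := starPendant_iso_of_pendantCount_eq (f := f) (g := treeBAttach n k l hq) e
    (pendantCount_eq_of_eq_off (by simp [hA]) e b₀ fun b hb => by
      rw [pendantCount_treeBAttach hq hn, h b hb])
  exact ⟨e₂.trans e₁.symm⟩

theorem starPendant_classification [Fintype A] [Fintype B] (f : A → B) {n : ℕ} (hn : 3 ≤ n)
    (hA : Fintype.card A = n) (hB : Fintype.card B = n + 1) :
    Nonempty (starPendant f ≃g treeB (n + 1) (n + 1) 0 0) ∨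
    Nonempty (starPendant f ≃g treeB (n + 1) (n + 1) 0 1) ∨
    Nonempty (starPendant f ≃g treeB (n + 1) (n + 1) 2 0) ∨
    Nonempty (starPendant f ≃g treeB (n + 1) (n + 1) 0 2) ∨
    ∀ b, pendantCount f b + 3 ≤ n := by
  classical
  have hsum : ∑ b, pendantCount f b = n := by rw [sum_pendantCount, Nat.card_eq_fintype_card, hA]
  by_cases hbig : ∀ b, pendantCount f b + 3 ≤ n
  · simp [hbig]
  push Not at hbig
  obtain ⟨b₀, hb₀⟩ := hbig
  set c := pendantCount f with hc
  have hrest : c b₀ + ∑ b ∈ Finset.univ.erase b₀, c b = n := by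
    rw [Finset.add_sum_erase _ _ (Finset.mem_univ _), hsum]
  have hcard : Fintype.card B = Fintype.card (Fin (n + 1)) := by simp [hB]
  by_cases hz : ∀ b, b ≠ b₀ → c b = 0
  · left
    obtain ⟨e, he⟩ := exists_equiv_eq_on hcard {b₀} (fun _ => ⟨0, by omega⟩) (by simp)
    have he₀ := he b₀ (by simp)
    refine iso_treeB_of_pendantCount hA (by omega) (by omega) e (b₀ := b₀) fun b hb => ?_
    have h0 : (e b).val ≠ 0 := fun h => hb (e.injective (he₀ ▸ Fin.ext h))
    rw [← hc, hz b hb]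
    split_ifs <;> omega
  right
  push Not at hz
  obtain ⟨b₁, hb₁, hcb₁⟩ := hz
  have hrest₁ : c b₀ + (c b₁ + ∑ b ∈ (Finset.univ.erase b₀).erase b₁, c b) = n := by
    rw [Finset.add_sum_erase _ _ (by simp [hb₁]), hrest]
  have hother : ∀ j : Fin (n + 1), j.val ≠ 0 → ∃ e : B ≃ Fin (n + 1), (e b₀).val = 0 ∧ e b₁ = j := by
    intro j hj
    obtain ⟨e, he⟩ := exists_equiv_eq_on hcard {b₀, b₁} (fun b => if b = b₀ then ⟨0, by omega⟩ else j)
      (by simp [Set.injOn_pair, hb₁, Fin.ext_iff]; omega)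
    exact ⟨e, by simp [he b₀ (by simp)], by simp [he b₁ (by simp), hb₁]⟩
  by_cases hz₁ : ∀ b, b ≠ b₀ → b ≠ b₁ → c b = 0
  · have hzero : ∑ b ∈ (Finset.univ.erase b₀).erase b₁, c b = 0 :=
      Finset.sum_eq_zero fun b hb => by
        simp only [Finset.mem_erase] at hb
        exact hz₁ b hb.2.1 hb.1
    rcases (by omega : c b₁ = 1 ∨ c b₁ = 2) with h1 | h1
    · left
      -- Index 2 is w₁; index 1 is v, which carries no leaf when k = 0.
      obtain ⟨e, he₀, he₁⟩ := hother ⟨2, by omega⟩ (by simp)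
      refine iso_treeB_of_pendantCount hA (by omega) (by omega) e (b₀ := b₀) fun b hb => ?_
      have h0 : (e b).val ≠ 0 := fun h => hb (e.injective (Fin.ext (h.trans he₀.symm)))
      rw [← hc]
      by_cases hbb : b = b₁
      · simp [hbb, he₁, h1]
      · have h2 : (e b).val ≠ 2 := fun h => hbb (e.injective (he₁ ▸ Fin.ext h))
        rw [hz₁ b hb hbb]
        split_ifs <;> omega
    · right; left
      obtain ⟨e, he₀, he₁⟩ := hother ⟨1, by omega⟩ (by simp)
      refine iso_treeB_of_pendantCount hA (by omega) (by omega) e (b₀ := b₀) fun b hb => ?_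
      have h0 : (e b).val ≠ 0 := fun h => hb (e.injective (Fin.ext (h.trans he₀.symm)))
      rw [← hc]
      by_cases hbb : b = b₁
      · simp [hbb, he₁, h1]
      · have h2 : (e b).val ≠ 1 := fun h => hbb (e.injective (he₁ ▸ Fin.ext h))
        rw [hz₁ b hb hbb]
        split_ifs <;> omega
  right; right; left
  push Not at hz₁
  obtain ⟨b₂, hb₂, hb₂₁, hcb₂⟩ := hz₁
  have hrest₂ : c b₀ + (c b₁ + (c b₂ + ∑ b ∈ ((Finset.univ.erase b₀).erase b₁).erase b₂, c b)) = n := by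
    rw [Finset.add_sum_erase _ _ (by simp [hb₂, hb₂₁]), hrest₁]
  have hzero : ∑ b ∈ ((Finset.univ.erase b₀).erase b₁).erase b₂, c b = 0 := by omega
  rw [Finset.sum_eq_zero_iff] at hzero
  obtain ⟨e, he⟩ := exists_equiv_eq_on hcard {b₀, b₁, b₂}
    (fun b => if b = b₀ then ⟨0, by omega⟩ else if b = b₁ then ⟨2, by omega⟩ else ⟨3, by omega⟩) (by
      intro x hx y hy hxy
      simp only [Finset.coe_insert, Finset.coe_singleton, Set.mem_insert_iff,
        Set.mem_singleton_iff] at hx hy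
      rcases hx with rfl | rfl | rfl <;> rcases hy with rfl | rfl | rfl <;>
        simp [hb₁, hb₂, hb₂₁] at hxy ⊢)
  have he₀ : e b₀ = ⟨0, by omega⟩ := by simp [he b₀ (by simp)]
  have he₁ : e b₁ = ⟨2, by omega⟩ := by simp [he b₁ (by simp), hb₁]
  have he₂ : e b₂ = ⟨3, by omega⟩ := by simp [he b₂ (by simp), hb₂, hb₂₁]
  refine iso_treeB_of_pendantCount hA (by omega) (by omega) e (b₀ := b₀) fun b hb => ?_
  have h0 : (e b).val ≠ 0 := fun h => hb (e.injective (he₀ ▸ Fin.ext h))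
  rw [← hc]
  by_cases hbb₁ : b = b₁
  · have : c b₁ = 1 := by omega
    simp [hbb₁, he₁, this]
  by_cases hbb₂ : b = b₂
  · have : c b₂ = 1 := by omega
    simp [hbb₂, he₂, this]
  have h2 : (e b).val ≠ 2 := fun h => hbb₁ (e.injective (he₁ ▸ Fin.ext h))
  have h3 : (e b).val ≠ 3 := fun h => hbb₂ (e.injective (he₂ ▸ Fin.ext h))
  rw [hzero b (by simp [hb, hbb₁, hbb₂])]
  split_ifs <;> omega

end Iso

/-! ### Comparison with B^{0,2} -/

section Comparison

variable {V W : Type*} [Fintype V] [Fintype W]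

theorem isBipartiteWith_treeB (p q k l : ℕ) :
    (treeB p q k l).IsBipartiteWith (Set.range Sum.inl) (Set.range Sum.inr) where
  disjoint := Set.isCompl_range_inl_range_inr.disjoint
  mem_of_adj := by
    rintro (a | a) (b | b) h
    · exact h.elim
    · simp
    · simp
    · exact h.elim

theorem SLt.of_iso {V' : Type*} [Fintype V'] {G : SimpleGraph V} {G' : SimpleGraph V'}
    {H : SimpleGraph W} (e : G ≃g G') (h : SLt G' H) : SLt G H := by
  obtain ⟨hcard, k, hk, hkV, heq, hlt⟩ := h
  refine ⟨e.card_eq.trans hcard, k, hk, e.card_eq ▸ hkV, fun i hi => ?_, ?_⟩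
  · rw [e.spectralMoment_eq, heq i hi]
  · rwa [e.spectralMoment_eq]

theorem sum_pendantCount_pow_treeB_zero_two {n : ℕ} (hn : 3 ≤ n) {r : ℕ} (hr : 0 < r) :
    ∑ j, pendantCount (treeBAttach n 0 2 (q := n + 1) (by omega)) j ^ r = (n - 2) ^ r + 2 := by
  -- This makes q = m + 4, so that indices 0 to 3 can be peeled off; the other m vertices carry no
  -- leaves.
  obtain ⟨m, rfl⟩ : ∃ m, n = m + 3 := ⟨n - 3, by omega⟩
  simp only [pendantCount_treeBAttach _ (show 0 + 2 ≤ m + 3 by omega)]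
  rw [Fin.sum_univ_eq_sum_range fun j => (if j = 0 then m + 3 - 0 - 2 else if j = 1 then 0 else
      if j < 2 + 2 then 1 else 0) ^ r]
  simp only [Finset.sum_range_succ']
  have hlarge : ∀ x, ¬ x + 1 + 1 + 1 + 1 < 4 := by omega
  simp [hr.ne', hlarge]
  exact add_comm _ _

/-- The first even spectral moments of `B_{n+1,n+1}^{0,2}`. -/
theorem spectralMoment_treeB_zero_two {n : ℕ} (hn : 3 ≤ n) :
    spectralMoment (treeB (n + 1) (n + 1) 0 2) 2 = 2 * (2 * n + 1) ∧
    spectralMoment (treeB (n + 1) (n + 1) 0 2) 4 =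
      2 * ((n + 1) ^ 2 + 2 * n + ((n - 2) ^ 2 + 2)) ∧
    spectralMoment (treeB (n + 1) (n + 1) 0 2) 6 =
      2 * ((n + 1) ^ 3 + 3 * (n + 1) * n + 3 * ((n - 2) ^ 2 + 2) + ((n - 2) ^ 3 + 2)) := by
  obtain ⟨e⟩ := treeB_iso_starPendant n 0 2 (q := n + 1) (by omega)
  have hsum : ∀ r, 0 < r → ∑ j, (pendantCount (treeBAttach n 0 2 (q := n + 1) (by omega)) j : ℝ) ^ r
      = ((n : ℝ) - 2) ^ r + 2 := fun r hr => by
    have := congrArg (Nat.cast (R := ℝ)) (sum_pendantCount_pow_treeB_zero_two hn hr)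
    push_cast [Nat.cast_sub (show 2 ≤ n by omega)] at this
    exact this
  have h1 := hsum 1 one_pos
  simp only [pow_one] at h1
  rw [e.spectralMoment_eq, e.spectralMoment_eq, e.spectralMoment_eq,
    spectralMoment_starPendant_two, spectralMoment_starPendant_four,
    spectralMoment_starPendant_six, h1, hsum 2 two_pos, hsum 3 three_pos]
  simp only [Fintype.card_fin]
  push_cast
  refine ⟨by ring, by ring, by ring⟩

theorem starPendant_sLt_treeB {A B : Type*} [Fintype A] [Fintype B] (f : A → B) {n : ℕ}
    (hn : 3 ≤ n) (hA : Fintype.card A = n) (hB : Fintype.card B = n + 1)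
    (hf : ∀ b, pendantCount f b + 3 ≤ n) :
    SLt (starPendant f) (treeB (n + 1) (n + 1) 0 2) := by
  obtain ⟨h2, h4, h6⟩ := spectralMoment_treeB_zero_two hn
  have hsum : ∑ b, pendantCount f b = n := by rw [sum_pendantCount, Nat.card_eq_fintype_card, hA]
  have hsumR : ∑ b, (pendantCount f b : ℝ) = n := by exact_mod_cast hsum
  have hcard : Fintype.card (Option A ⊕ B) = Fintype.card (Fin (n + 1) ⊕ Fin (n + 1)) := by
    simp [hA, hB]
  have hcard' : Fintype.card (Option A ⊕ B) = n + 1 + (n + 1) := by simp [hA, hB]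
  have h2f : spectralMoment (starPendant f) 2 = spectralMoment (treeB (n + 1) (n + 1) 0 2) 2 := by
    rw [spectralMoment_starPendant_two, h2, hsumR, hB]
    push_cast
    ring
  rcases sum_sq_lt_or_of_forall_add_three_le (by omega) hsum fun b _ => hf b with h | ⟨h, rfl⟩
  · refine SLt.of_bipartite (k := 2) (isBipartiteWith_starPendant f) (isBipartiteWith_treeB ..) hcard
      two_pos (by omega) (fun i hi hi2 => ?_) ?_
    · obtain rfl : i = 1 := by omega
      exact h2f
    · have h' : (∑ b, (pendantCount f b : ℝ) ^ 2) + 4 * n < (n : ℝ) ^ 2 + 6 := by exact_mod_cast h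
      rw [show 2 * 2 = 4 from rfl, h4, spectralMoment_starPendant_four, hsumR, hB]
      push_cast
      nlinarith
  · have hsq : ∑ b, pendantCount f b ^ 2 = 18 := by omega
    have hsqR : ∑ b, (pendantCount f b : ℝ) ^ 2 = 18 := by exact_mod_cast hsq
    -- All counts are at most 3, so c³ ≤ 3c²; the competitor has 4³ + 1 + 1 = 66.
    have hcube : ∑ b, pendantCount f b ^ 3 ≤ 54 := by
      calc ∑ b, pendantCount f b ^ 3 ≤ ∑ b, 3 * pendantCount f b ^ 2 := by
            refine Finset.sum_le_sum fun b _ => ?_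
            rw [pow_succ, mul_comm]
            exact Nat.mul_le_mul_right _ (by have := hf b; omega)
        _ = 54 := by rw [← Finset.mul_sum, hsq]; norm_num
    have hcubeR : ∑ b, (pendantCount f b : ℝ) ^ 3 ≤ 54 := by exact_mod_cast hcube
    refine SLt.of_bipartite (k := 3) (isBipartiteWith_starPendant f) (isBipartiteWith_treeB ..) hcard
      three_pos (by omega) (fun i hi hi3 => ?_) ?_
    · rcases (by omega : i = 1 ∨ i = 2) with rfl | rfl
      · exact h2f
      · rw [show 2 * 2 = 4 from rfl, h4, spectralMoment_starPendant_four, hsumR, hB, hsqR]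
        push_cast
        norm_num
    · rw [show 2 * 3 = 6 from rfl, h6, spectralMoment_starPendant_six, hsumR, hB, hsqR]
      push_cast
      linarith

theorem iso_starPendant_of_dominating {V : Type*} {G : SimpleGraph V} {s t : Set V}
    (h : G.IsBipartiteWith s t) (hst : s ∪ t = Set.univ) {x : V} (hx : x ∈ s)
    (hxt : ∀ y ∈ t, G.Adj x y) (f : {y // y ∈ s ∧ y ≠ x} → t)
    (hf : ∀ y z, G.Adj y.val z ↔ z = (f y).val) : Nonempty (G ≃g starPendant f) := by
  let g : Option {y // y ∈ s ∧ y ≠ x} ⊕ t → V :=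
    Sum.elim (fun o => o.elim x Subtype.val) Subtype.val
  have hgs : ∀ o, g (Sum.inl o) ∈ s := by
    rintro (_ | y)
    · exact hx
    · exact y.2.1
  have hdisj : ∀ o (z : t), g (Sum.inl o) ≠ z.val := fun o z he =>
    Set.disjoint_left.mp h.disjoint (hgs o) (he ▸ z.2)
  have hbij : Function.Bijective g := by
    constructor
    · rintro (a | a) (b | b) hab
      · rcases a with _ | a <;> rcases b with _ | b
        · rfl
        · exact (b.2.2 hab.symm).elim
        · exact (a.2.2 hab).elim
        · rw [Subtype.ext hab]
      · exact (hdisj a b hab).elim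
      · exact (hdisj b a hab.symm).elim
      · rw [Subtype.ext hab]
    · intro v
      rcases (hst ▸ Set.mem_univ v : v ∈ s ∪ t) with hv | hv
      · by_cases hvx : v = x
        · exact ⟨Sum.inl none, hvx.symm⟩
        · exact ⟨Sum.inl (some ⟨v, hv, hvx⟩), rfl⟩
      · exact ⟨Sum.inr ⟨v, hv⟩, rfl⟩
  have key : ∀ o (z : t), G.Adj (g (Sum.inl o)) z.val ↔ ∀ y ∈ o, f y = z := by
    rintro (_ | y) z
    · simpa [g] using hxt z z.2
    · simp only [Option.mem_some_iff, forall_eq']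
      rw [Subtype.ext_iff]
      exact (hf y z).trans eq_comm
  refine ⟨SimpleGraph.Iso.symm ⟨Equiv.ofBijective g hbij, ?_⟩⟩
  rintro (a | a) (b | b)
  · refine iff_of_false (fun hab => ?_) id
    exact Set.disjoint_left.mp h.disjoint (hgs b) (h.mem_of_mem_adj (hgs a) hab)
  · exact key a b
  · exact (G.adj_comm _ _).trans (key b a)
  · refine iff_of_false (fun hab => ?_) id
    exact Set.disjoint_left.mp h.disjoint (h.mem_of_mem_adj' b.2 hab) a.2

universe u

variable {V : Type u} [Fintype V] [DecidableEq V] {T : SimpleGraph V} [DecidableRel T.Adj]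
  {s t : Finset V} {n : ℕ}

theorem SimpleGraph.IsTree.sum_degree_of_bipartition (hT : T.IsTree)
    (h : T.IsBipartiteWith (s : Set V) t) (hst : s ∪ t = Finset.univ) (hs : s.card = n + 1)
    (ht : t.card = n + 1) : ∑ v ∈ s, T.degree v = 2 * n + 1 := by
  have hcard : Fintype.card V = 2 * n + 2 := by
    rw [← Finset.card_univ, ← hst, Finset.card_union_of_disjoint (Finset.disjoint_coe.mp h.disjoint)]
    omega
  rw [SimpleGraph.isBipartiteWith_sum_degrees_eq_card_edges h]
  have := hT.card_edgeFinset
  omega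

/-- The degrees in `s` sum to 2n + 1, so the n vertices other than `x` have total degree n; each has
degree at least 1, hence exactly 1. -/
theorem SimpleGraph.IsTree.iso_starPendant_of_degree_eq (hT : T.IsTree) (hn : 0 < n)
    (h : T.IsBipartiteWith (s : Set V) t) (hst : s ∪ t = Finset.univ) (hs : s.card = n + 1)
    (ht : t.card = n + 1) {x : V} (hx : x ∈ s) (hdeg : T.degree x = n + 1) :
    ∃ (A B : Type u) (_ : Fintype A) (_ : Fintype B) (f : A → B), Fintype.card A = n ∧
      Fintype.card B = n + 1 ∧ Nonempty (T ≃g starPendant f) := by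
  have hnt : Nontrivial V := by
    obtain ⟨a, -, b, -, hab⟩ := Finset.one_lt_card.mp (show 1 < s.card by omega)
    exact ⟨a, b, hab⟩
  have hpos : ∀ v, 1 ≤ T.degree v := fun v => hT.1.preconnected.degree_pos_of_nontrivial v
  have hnbr : T.neighborFinset x = t :=
    Finset.eq_of_subset_of_card_le (SimpleGraph.isBipartiteWith_neighborFinset_subset h hx)
      (by rw [SimpleGraph.card_neighborFinset_eq_degree, hdeg, ht])
  have hleaf : ∀ v ∈ s.erase x, 1 = T.degree v := by
    rw [← Finset.sum_eq_sum_iff_of_le fun v _ => hpos v]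
    have := hT.sum_degree_of_bipartition h hst hs ht
    rw [← Finset.add_sum_erase _ _ hx, hdeg] at this
    rw [Finset.sum_const, Finset.card_erase_of_mem hx, hs, smul_eq_mul]
    omega
  have hunique : ∀ y : {y // y ∈ (s : Set V) ∧ y ≠ x}, ∃ z : (t : Set V),
      ∀ w, T.Adj y.val w ↔ w = z.val := by
    rintro ⟨y, hys, hyx⟩
    have h1 : (T.neighborFinset y).card = 1 := by
      rw [SimpleGraph.card_neighborFinset_eq_degree, ← hleaf y (Finset.mem_erase.mpr ⟨hyx, hys⟩)]
    obtain ⟨z, hz⟩ := Finset.card_eq_one.mp h1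
    have hadj : ∀ w, T.Adj y w ↔ w = z := fun w => by
      rw [← SimpleGraph.mem_neighborFinset, hz, Finset.mem_singleton]
    exact ⟨⟨z, h.mem_of_mem_adj hys ((hadj z).mpr rfl)⟩, hadj⟩
  choose f hf using hunique
  refine ⟨{y // y ∈ (s : Set V) ∧ y ≠ x}, (t : Set V), inferInstance, inferInstance, f, ?_,
    by simp [ht], iso_starPendant_of_dominating h (by exact_mod_cast hst) hx (fun y hy => ?_) f hf⟩
  · rw [Fintype.card_subtype]
    have : (Finset.univ.filter fun y => y ∈ (s : Set V) ∧ y ≠ x) = s.erase x := by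
      ext y
      simp [and_comm]
    rw [this, Finset.card_erase_of_mem hx, hs]
    rfl
  · rw [← SimpleGraph.mem_neighborFinset, hnbr]
    exact hy

theorem SimpleGraph.IsTree.sum_degree_sq_le_of_bipartition (hT : T.IsTree) (hn : 0 < n)
    (h : T.IsBipartiteWith (s : Set V) t) (hst : s ∪ t = Finset.univ) (hs : s.card = n + 1)
    (ht : t.card = n + 1) (hdeg : ∀ v ∈ s, T.degree v ≠ n + 1) :
    ∑ v ∈ s, T.degree v ^ 2 ≤ n ^ 2 + n + 3 := by
  have hnt : Nontrivial V := by
    obtain ⟨a, -, b, -, hab⟩ := Finset.one_lt_card.mp (show 1 < s.card by omega)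
    exact ⟨a, b, hab⟩
  have hpos : ∀ v, 1 ≤ T.degree v := fun v => hT.1.preconnected.degree_pos_of_nontrivial v
  -- The excess degrees a = d - 1 sum to n, and each is at most n - 1.
  choose a ha using fun v => Nat.exists_eq_add_of_le' (hpos v)
  have hsum := hT.sum_degree_of_bipartition h hst hs ht
  have hle : ∀ v ∈ s, a v + 1 ≤ n := fun v hv => by
    have h1 := SimpleGraph.isBipartiteWith_degree_le h hv
    have h2 := hdeg v hv
    have h3 := ha v
    omega
  simp only [ha, Finset.sum_add_distrib, Finset.sum_const, hs, smul_eq_mul, mul_one] at hsum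
  have hsum' : ∑ v ∈ s, a v = n := by omega
  have := sum_sq_le_of_forall_add_one_le hn hsum' hle
  simp only [ha, add_sq, Finset.sum_add_distrib, Finset.sum_const, hs, smul_eq_mul, mul_one,
    one_pow, ← Finset.mul_sum, hsum']
  omega

theorem SimpleGraph.IsTree.sLt_treeB_of_degree_ne (hT : T.IsTree) (hn : 3 ≤ n)
    (h : T.IsBipartiteWith (s : Set V) t) (hst : s ∪ t = Finset.univ) (hs : s.card = n + 1)
    (ht : t.card = n + 1) (hdeg : ∀ v, T.degree v ≠ n + 1) :
    SLt T (treeB (n + 1) (n + 1) 0 2) := by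
  obtain ⟨h2, h4, -⟩ := spectralMoment_treeB_zero_two hn
  have hts : t ∪ s = Finset.univ := by rw [Finset.union_comm, hst]
  have hdisj := Finset.disjoint_coe.mp h.disjoint
  have hcard : Fintype.card V = n + 1 + (n + 1) := by
    rw [← Finset.card_univ, ← hst, Finset.card_union_of_disjoint hdisj, hs, ht]
  have hd : ∑ v, T.degree v = 2 * (2 * n + 1) := by
    rw [← hst, Finset.sum_union hdisj, hT.sum_degree_of_bipartition h hst hs ht,
      hT.sum_degree_of_bipartition h.symm hts ht hs]
    ring
  have hd2 : ∑ v, T.degree v ^ 2 ≤ 2 * (n ^ 2 + n + 3) := by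
    rw [← hst, Finset.sum_union hdisj, two_mul]
    exact add_le_add
      (hT.sum_degree_sq_le_of_bipartition (by omega) h hst hs ht fun v _ => hdeg v)
      (hT.sum_degree_sq_le_of_bipartition (by omega) h.symm hts ht hs fun v _ => hdeg v)
  have hdR : ∑ v, (T.degree v : ℝ) = 2 * (2 * n + 1) := by exact_mod_cast hd
  have hd2R : ∑ v, (T.degree v : ℝ) ^ 2 ≤ 2 * ((n : ℝ) ^ 2 + n + 3) := by exact_mod_cast hd2
  refine SLt.of_bipartite (k := 2) h (isBipartiteWith_treeB ..) (by simp [hcard]) two_pos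
    (by omega) (fun i hi hi2 => ?_) ?_
  · obtain rfl : i = 1 := by omega
    rw [mul_one, h2, spectralMoment_two, hdR]
  · rw [show 2 * 2 = 4 from rfl, h4, hT.2.spectralMoment_four, hdR]
    nlinarith

end Comparison

theorem theorem2p5 (p q : ℕ) (hp : 4 ≤ p) (hpq : p = q)
    {V : Type*} [Fintype V] (T : SimpleGraph V) (hT : IsTreeWithBipartition T p q)
    (h00 : ¬ Nonempty (T ≃g treeB p q 0 0))
    (h01 : ¬ Nonempty (T ≃g treeB p q 0 1))
    (h20 : ¬ Nonempty (T ≃g treeB p q 2 0)) :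
    SLe T (treeB p q 0 2) ∧
      (SEq T (treeB p q 0 2) ↔ Nonempty (T ≃g treeB p q 0 2)) := by
  classical
  subst hpq
  obtain ⟨n, rfl⟩ : ∃ n, p = n + 1 := ⟨p - 1, by omega⟩
  obtain ⟨htree, -, s, t, h, hst, hs, ht⟩ := hT
  lift s to Finset V using s.toFinite
  lift t to Finset V using t.toFinite
  rw [Set.ncard_coe_finset] at hs ht
  have hst : s ∪ t = Finset.univ := by exact_mod_cast hst
  have hmain : Nonempty (T ≃g treeB (n + 1) (n + 1) 0 2) ∨ SLt T (treeB (n + 1) (n + 1) 0 2) := by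
    by_cases hdeg : ∀ v, T.degree v ≠ n + 1
    · exact Or.inr (htree.sLt_treeB_of_degree_ne (by omega) h hst hs ht hdeg)
    push Not at hdeg
    obtain ⟨x, hx⟩ := hdeg
    -- Since p = q, the class containing `x` can play the white part, whichever it is.
    obtain ⟨A, B, _, _, f, hA, hB, ⟨e⟩⟩ :=
      (Finset.mem_union.mp (hst ▸ Finset.mem_univ x)).elim
        (fun hxs => htree.iso_starPendant_of_degree_eq (by omega) h hst hs ht hxs hx)
        (fun hxt => htree.iso_starPendant_of_degree_eq (by omega) h.symm
          (by rw [Finset.union_comm, hst]) ht hs hxt hx)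
    rcases starPendant_classification f (by omega) hA hB with ⟨⟨e'⟩⟩ | ⟨⟨e'⟩⟩ | ⟨⟨e'⟩⟩ | ⟨⟨e'⟩⟩ | hf
    · exact (h00 ⟨e.trans e'⟩).elim
    · exact (h01 ⟨e.trans e'⟩).elim
    · exact (h20 ⟨e.trans e'⟩).elim
    · exact Or.inl ⟨e.trans e'⟩
    · exact Or.inr (SLt.of_iso e (starPendant_sLt_treeB f (by omega) hA hB hf))
  rcases hmain with ⟨⟨e⟩⟩ | hlt
  · exact ⟨Or.inr e.sEq, fun _ => ⟨e⟩, fun _ => e.sEq⟩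
  · exact ⟨Or.inl hlt, fun heq => (hlt.not_sEq heq).elim, fun ⟨e⟩ => e.sEq⟩
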